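/- Let $\alpha=(\alpha_n)_{n\in\mathbb N}$, $\mathbb N=\{1,2,\dots\}$, be a strictly increasing sequence of positive reals with $\alpha_n\to\infty$, let $(s_k)_{k\in\mathbb N}\subset(1,\infty)$ be strictly increasing with $s_k\to\infty$, and put $v_k(n):=s_k^{-\alpha_n}$ for $k,n\in\mathbb N$. Let $c_0(v_k)$ be the Banach space of all $x\in\mathbb C^{\mathbb N}$ with $\lim_n v_k(n)x_n=0$, with norm $q_k(x)=\sup_n v_k(n)|x_n|$, and let $E_\alpha:=\operatorname{ind}_k c_0(v_k)$, that is, $E_\alpha=\bigcup_k c_0(v_k)$ with the finest locally convex (Hausdorff) topology for which all inclusions $c_0(v_k)\hookrightarrow E_\alpha$ are continuous. Let $D:\mathbb C^{\mathbb N}\to\mathbb C^{\mathbb N}$ be the differentiation operator $D(x_1,x_2,x_3,\dots):=(x_2,2x_3,3x_4,\dots)$. Call $E_\alpha$ shift stable if $\limsup_{n\to\infty}\alpha_{n+1}/\alpha_n<\infty$, and call a locally convex space nuclear if for every continuous seminorm $p$ there is a continuous seminorm $q\ge p$ such that the canonical map between the local Banach spaces (the Hausdorff completions with respect to $q$ and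 $p$) is a nuclear operator. **Proposition 2.5.** The following assertions are equivalent. (i) $D(E_\alpha)\subset E_\alpha$, i.e. $D$ acts in $E_\alpha$. (ii) $D\in\mathcal L(E_\alpha)$, i.e. $D$ is a continuous linear operator from $E_\alpha$ into $E_\alpha$. (iii) For every $k\in\mathbb N$ there exists $l\in\mathbb N$ with $l>k$ such that $D:c_0(v_k)\to c_0(v_l)$ is continuous. (iv) For every $k\in\mathbb N$ there exist $l\in\mathbb N$ with $l>k$ and $M>0$ such that $n\,v_l(n)\le M\,v_k(n+1)$ for all $n\in\mathbb N$. (v) The space $E_\alpha$ is both nuclear and shift stable. -/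

import Mathlib

open Filter Topology

/-! Conventions: sequences are indexed by `ℕ` starting at `0`, so that the entry `x n` in the code is
the `(n + 1)`-st entry of the sequence in the usual numbering from `1`.  The same applies to the
exponents `α`, to the bases `s` and to the steps of the inductive limit. -/

noncomputable section

/-! ### Weighted `c₀`-spaces -/

/-- The vector space `c₀(v)` of all complex sequences `x` such that `v x` is a null sequence. -/
def c0Submodule (v : ℕ → ℝ) : Submodule ℂ (ℕ → ℂ) where
  carrier := {x | Tendsto (fun n => v n * ‖x n‖) atTop (𝓝 0)}
  zero_mem' := by simp
  add_mem' := by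
    intro x y hx hy
    have hx' : Tendsto (fun n => |v n * ‖x n‖|) atTop (𝓝 0) := by
      have h : Tendsto (fun n => v n * ‖x n‖) atTop (𝓝 0) := hx
      simpa using h.abs
    have hy' : Tendsto (fun n => |v n * ‖y n‖|) atTop (𝓝 0) := by
      have h : Tendsto (fun n => v n * ‖y n‖) atTop (𝓝 0) := hy
      simpa using h.abs
    refine squeeze_zero_norm (fun n => ?_) (by simpa using hx'.add hy')
    simp only [Real.norm_eq_abs, abs_mul, abs_norm, ← mul_add, Pi.add_apply]
    exact mul_le_mul_of_nonneg_left (norm_add_le _ _) (abs_nonneg _)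
  smul_mem' := by
    intro c x hx
    have h : Tendsto (fun n => v n * ‖x n‖) atTop (𝓝 0) := hx
    have := h.const_mul ‖c‖
    rw [mul_zero] at this
    refine this.congr (fun n => ?_)
    simp only [Pi.smul_apply, norm_smul]
    ring

/-- `c₀(v)` as a type of its own; its topology is that of the weighted supremum norm. -/
def WeightedC0 (v : ℕ → ℝ) : Type := c0Submodule v

namespace WeightedC0

variable (v : ℕ → ℝ)

instance : AddCommGroup (WeightedC0 v) := inferInstanceAs (AddCommGroup (c0Submodule v))

instance : Module ℂ (WeightedC0 v) := inferInstanceAs (Module ℂ (c0Submodule v))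

/-- The inclusion of `c₀(v)` into the space of all sequences. -/
def toSeq : WeightedC0 v →ₗ[ℂ] (ℕ → ℂ) := (c0Submodule v).subtype

theorem bddAbove (x : WeightedC0 v) : BddAbove (Set.range fun n => |v n| * ‖toSeq v x n‖) := by
  have h : Tendsto (fun n => v n * ‖toSeq v x n‖) atTop (𝓝 0) := x.2
  simpa [abs_mul] using h.abs.bddAbove_range

/-- The weighted supremum norm `x ↦ sup_n |v n| |x n|`; for positive weights this is a norm. -/
def supNorm : Seminorm ℂ (WeightedC0 v) :=
  Seminorm.of (fun x => ⨆ n, |v n| * ‖toSeq v x n‖)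
    (by
      intro x y
      refine ciSup_le fun n => ?_
      calc |v n| * ‖toSeq v (x + y) n‖
          ≤ |v n| * ‖toSeq v x n‖ + |v n| * ‖toSeq v y n‖ := by
            rw [map_add, Pi.add_apply, ← mul_add]
            exact mul_le_mul_of_nonneg_left (norm_add_le _ _) (abs_nonneg _)
        _ ≤ _ := add_le_add (le_ciSup (bddAbove v x) n) (le_ciSup (bddAbove v y) n))
    (by
      intro c x
      rw [Real.mul_iSup_of_nonneg (norm_nonneg c)]
      congr 1
      ext n
      rw [map_smul, Pi.smul_apply, norm_smul]
      ring)

instance : SeminormedAddCommGroup (WeightedC0 v) :=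
  (supNorm v).toAddGroupSeminorm.toSeminormedAddCommGroup

instance : NormedSpace ℂ (WeightedC0 v) where
  norm_smul_le c x := le_of_eq (map_smul_eq_mul (supNorm v) c x)

theorem norm_eq (x : WeightedC0 v) : ‖x‖ = ⨆ n, |v n| * ‖toSeq v x n‖ := rfl

theorem le_norm (x : WeightedC0 v) (n : ℕ) : |v n| * ‖toSeq v x n‖ ≤ ‖x‖ :=
  le_ciSup (bddAbove v x) n

end WeightedC0

/-! ### Locally convex inductive limits of weighted `c₀`-spaces -/

/-- The vector space spanned by the spaces `c₀(v k)`; see `mem_coechelonSubmodule_iff`: it is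
their union if the weights decrease in `k`. -/
def coechelonSubmodule (v : ℕ → ℕ → ℝ) : Submodule ℂ (ℕ → ℂ) := ⨆ k, c0Submodule (v k)

theorem mem_coechelonSubmodule_iff {v : ℕ → ℕ → ℝ} (h0 : ∀ k n, 0 ≤ v k n) (hv : Antitone v)
    (x : ℕ → ℂ) : x ∈ coechelonSubmodule v ↔ ∃ k, x ∈ c0Submodule (v k) := by
  refine Submodule.mem_iSup_of_directed _ (Monotone.directed_le fun k l hkl y hy => ?_)
  refine squeeze_zero (fun n => mul_nonneg (h0 l n) (norm_nonneg _)) (fun n => ?_) hy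
  exact mul_le_mul_of_nonneg_right (hv hkl n) (norm_nonneg _)

/-- The co-echelon space `ind_k c₀(v k)`. -/
def Coechelon (v : ℕ → ℕ → ℝ) : Type := coechelonSubmodule v

namespace Coechelon

variable (v : ℕ → ℕ → ℝ)

instance : AddCommGroup (Coechelon v) := inferInstanceAs (AddCommGroup (coechelonSubmodule v))

instance : Module ℂ (Coechelon v) := inferInstanceAs (Module ℂ (coechelonSubmodule v))

/-- The inclusion of the co-echelon space into the space of all sequences. -/
def toSeq : Coechelon v →ₗ[ℂ] (ℕ → ℂ) := (coechelonSubmodule v).subtype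

/-- The inclusion of the step `c₀(v k)` into the co-echelon space. -/
def incl (k : ℕ) : WeightedC0 (v k) →ₗ[ℂ] Coechelon v :=
  Submodule.inclusion (le_iSup (fun k => c0Submodule (v k)) k)

/-- The inductive limit topology: the finest locally convex vector space topology for which all the
inclusions `c₀(v k) → ind_k c₀(v k)` are continuous.  (In Mathlib `t ≤ t'` means that `t` is finer
than `t'`, and `sInf` is the coarsest topology finer than all the given ones.) -/
instance : TopologicalSpace (Coechelon v) :=
  sInf {t : TopologicalSpace (Coechelon v) |
    @IsTopologicalAddGroup _ t _ ∧ @ContinuousSMul ℂ _ _ _ t ∧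
    @LocallyConvexSpace ℝ _ _ _ _ _ t ∧ ∀ k, @Continuous _ _ _ t (incl v k)}

instance : IsTopologicalAddGroup (Coechelon v) := topologicalAddGroup_sInf fun _ h => h.1

instance : ContinuousSMul ℂ (Coechelon v) := continuousSMul_sInf fun _ h => h.2.1

instance : LocallyConvexSpace ℝ (Coechelon v) := .sInf fun _ h => h.2.2.1

theorem continuous_incl (k : ℕ) : Continuous (incl v k) :=
  continuous_sInf_rng.2 fun _ h => h.2.2.2 k

/-- For positive weights the inductive limit topology is finer than that of coordinatewise
convergence; in particular it is Hausdorff. -/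
theorem continuous_toSeq (hv : ∀ k n, 0 < v k n) : Continuous (toSeq v) := by
  rw [continuous_iff_le_induced]
  refine sInf_le ⟨topologicalAddGroup_induced (toSeq v), continuousSMul_induced (toSeq v),
    LocallyConvexSpace.induced ((toSeq v).restrictScalars ℝ), fun k => ?_⟩
  rw [continuous_induced_rng]
  refine continuous_pi fun n => ?_
  let f : WeightedC0 (v k) →ₗ[ℂ] ℂ := (LinearMap.proj n) ∘ₗ WeightedC0.toSeq (v k)
  refine (f.mkContinuous (|v k n|⁻¹) fun x => ?_).continuous
  have h : 0 < |v k n| := abs_pos.2 (hv k n).ne'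
  rw [inv_mul_eq_div, le_div_iff₀ h, mul_comm]
  exact WeightedC0.le_norm (v k) x n

theorem t2Space (hv : ∀ k n, 0 < v k n) : T2Space (Coechelon v) :=
  T2Space.of_injective_continuous (f := toSeq v) Subtype.val_injective (continuous_toSeq v hv)

end Coechelon

/-! ### Nuclear spaces -/

/-- A continuous linear operator `T : X → Y` is nuclear if `T x = ∑ a i (x) y i` for continuous
linear functionals `a i` on `X` and vectors `y i` of `Y` with `∑ ‖a i‖ ‖y i‖ < ∞`. -/
def IsNuclearOperator {𝕜 X Y : Type*} [RCLike 𝕜] [NormedAddCommGroup X] [NormedSpace 𝕜 X]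
    [NormedAddCommGroup Y] [NormedSpace 𝕜 Y] (T : X →L[𝕜] Y) : Prop :=
  ∃ (a : ℕ → X →L[𝕜] 𝕜) (y : ℕ → Y), Summable (fun i => ‖a i‖ * ‖y i‖) ∧
    ∀ x, HasSum (fun i => a i x • y i) (T x)

section Local

variable {𝕜 E : Type*} [RCLike 𝕜] [AddCommGroup E] [Module 𝕜 E]

/-- The vector space `E` seminormed by `p`. -/
def SeminormedBy (_p : Seminorm 𝕜 E) : Type _ := E

instance (p : Seminorm 𝕜 E) : SeminormedAddCommGroup (SeminormedBy p) :=
  p.toAddGroupSeminorm.toSeminormedAddCommGroup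

instance (p : Seminorm 𝕜 E) : Module 𝕜 (SeminormedBy p) := inferInstanceAs (Module 𝕜 E)

instance (p : Seminorm 𝕜 E) : NormedSpace 𝕜 (SeminormedBy p) where
  norm_smul_le c x := le_of_eq (map_smul_eq_mul p c x)

/-- The local Banach space of a seminorm `p`: the Hausdorff completion of `(E, p)`, that is, the
completion of the normed space `E / ker p`. -/
abbrev LocalBanach (p : Seminorm 𝕜 E) : Type _ := UniformSpace.Completion (SeminormedBy p)

/-- The identity of `E` as a continuous map from `(E, q)` to `(E, p)`, for `p ≤ q`. -/
def seminormedId {p q : Seminorm 𝕜 E} (h : p ≤ q) : SeminormedBy q →L[𝕜] SeminormedBy p :=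
  LinearMap.mkContinuous
    { toFun := fun x => x, map_add' := fun _ _ => rfl, map_smul' := fun _ _ => rfl } 1
    (fun x => by rw [one_mul]; exact h x)

/-- The canonical map between the local Banach spaces of two seminorms `p ≤ q`. -/
def localBanachMap {p q : Seminorm 𝕜 E} (h : p ≤ q) : LocalBanach q →L[𝕜] LocalBanach p :=
  (seminormedId h).completion

end Local

/-- A locally convex space `E` is nuclear if for every continuous seminorm `p` there is a continuous
seminorm `q ≥ p` for which the canonical map between the local Banach spaces is nuclear. -/
def IsNuclearSpace (𝕜 E : Type*) [RCLike 𝕜] [AddCommGroup E] [Module 𝕜 E]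
    [TopologicalSpace E] : Prop :=
  ∀ p : Seminorm 𝕜 E, Continuous p → ∃ q : Seminorm 𝕜 E, Continuous q ∧
    ∃ h : p ≤ q, IsNuclearOperator (localBanachMap h)

/-! ### Duals of power series spaces of infinite type, and differentiation -/

/-- The weights `v_k(n) = s_k ^ (-α_n)`. -/
def powerWeight (α s : ℕ → ℝ) (k n : ℕ) : ℝ := s k ^ (-α n)

/-- The co-echelon space `E_α = ind_k c₀(v_k)` for the weights `v_k(n) = s_k ^ (-α_n)`. -/
abbrev ESpace (α s : ℕ → ℝ) : Type := Coechelon (powerWeight α s)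

theorem mem_powerWeight_coechelon_iff {α s : ℕ → ℝ} (hα : ∀ n, 0 < α n) (hs : ∀ k, 1 < s k)
    (hs' : StrictMono s) (x : ℕ → ℂ) :
    x ∈ coechelonSubmodule (powerWeight α s) ↔ ∃ k, x ∈ c0Submodule (powerWeight α s k) := by
  refine mem_coechelonSubmodule_iff
    (fun k n => (Real.rpow_pos_of_pos (zero_lt_one.trans (hs k)) _).le) (fun k l hkl n => ?_) x
  exact Real.rpow_le_rpow_of_nonpos (zero_lt_one.trans (hs k)) (hs'.monotone hkl)
    (neg_nonpos.2 (hα n).le)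

/-- The differentiation operator `D (x₁, x₂, x₃, …) = (x₂, 2 x₃, 3 x₄, …)` on all sequences. -/
def diffOp : (ℕ → ℂ) →ₗ[ℂ] (ℕ → ℂ) where
  toFun x n := ((n : ℂ) + 1) * x (n + 1)
  map_add' x y := by ext n; simp [mul_add]
  map_smul' c x := by ext n; simp [mul_left_comm]

/-- Shift stability: `limsup α_{n+1} / α_n < ∞`, the upper limit being taken in `[-∞, ∞]`. -/
def ShiftStable (α : ℕ → ℝ) : Prop :=
  limsup (fun n => ((α (n + 1) / α n : ℝ) : EReal)) atTop < ⊤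

end

/-! Since `v_k(n) = exp (-(log s_k) α_n)`, taking logarithms turns the weight inequality (iv) into
`log (n + 1) + log s_k * α (n + 1) ≤ log s_l * α n + log M`. Both terms on the left are nonnegative,
`log M` is absorbed because `α n ≥ α 0 > 0`, and `log s_l` may be taken as large as desired. Hence
(iv) says exactly that `α (n + 1) = O(α n)`, which is shift stability, and that `log (n + 1) = O(α
n)`. The latter is nuclearity, and this is the main work.

If `log (n + 1) = O(α n)`, the weights absorb a factor `(n + 1) ^ 2`, so each continuous seminorm
`p` lies below a weighted sup seminorm for which `x = ∑ x n • e n` is a nuclear expansion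
(`isNuclearSpace_of_sq_mul_le`). Conversely, the trace of the identity on the span of the first `N`
unit vectors is `N`, and a nuclear expansion bounds it (`card_le_of_isNuclearSpace`). A weight
adapted to the running maximum of `log (n + 1) / α n` then bounds this quotient
(`log_le_of_isNuclearSpace`).

For the operator, (iv) gives continuity between steps, which passes to the inductive limit and in
particular gives invariance. Invariance gives back (iv) by a gliding hump
(`exists_weight_inequality_of_diffOp`). -/

noncomputable section

/-! ### Unit vectors in weighted `c₀`-spaces -/

namespace WeightedC0

variable {v : ℕ → ℝ}

theorem norm_le {x : WeightedC0 v} {B : ℝ} (h : ∀ n, |v n| * ‖toSeq v x n‖ ≤ B) : ‖x‖ ≤ B :=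
  ciSup_le h

theorem tendsto_toSeq (x : WeightedC0 v) :
    Tendsto (fun n => v n * ‖toSeq v x n‖) atTop (𝓝 0) := x.2

/-- The `n`-th unit vector as an element of `c₀(v)`. -/
def unit (v : ℕ → ℝ) (n : ℕ) : WeightedC0 v :=
  ⟨Pi.single n 1, by
    refine tendsto_const_nhds.congr' ?_
    filter_upwards [eventually_gt_atTop n] with m hm
    simp [Pi.single_eq_of_ne hm.ne']⟩

@[simp] theorem toSeq_unit (n : ℕ) : toSeq v (unit v n) = Pi.single n 1 := rfl

theorem norm_unit_le (n : ℕ) : ‖unit v n‖ ≤ |v n| := by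
  refine norm_le fun m => ?_
  rcases eq_or_ne m n with rfl | h
  · simp
  · simp [Pi.single_eq_of_ne h]

theorem toSeq_sum_smul_unit (a : ℕ → ℂ) (N m : ℕ) :
    toSeq v (∑ n ∈ Finset.range N, a n • unit v n) m = if m < N then a m else 0 := by
  simp [map_sum, Finset.sum_apply, Pi.single_apply]

theorem tendsto_sum_smul_unit (x : WeightedC0 v) :
    Tendsto (fun N => ∑ n ∈ Finset.range N, toSeq v x n • unit v n) atTop (𝓝 x) := by
  rw [Metric.tendsto_atTop]
  intro ε hε
  obtain ⟨N₀, hN₀⟩ := Metric.tendsto_atTop.1 (tendsto_toSeq x) (ε / 2) (half_pos hε)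
  refine ⟨N₀, fun N hN => ?_⟩
  rw [dist_eq_norm]
  refine (norm_le (B := ε / 2) fun m => ?_).trans_lt (half_lt_self hε)
  rw [map_sub, Pi.sub_apply, toSeq_sum_smul_unit]
  split_ifs with h
  · simp only [sub_self, norm_zero, mul_zero]; exact (half_pos hε).le
  · have := (hN₀ m (by omega)).le
    simpa [Real.dist_eq, abs_mul] using this

end WeightedC0

/-! ### Continuous maps and seminorms on co-echelon spaces -/

namespace Coechelon

variable {v : ℕ → ℕ → ℝ}

@[simp] theorem toSeq_incl (k : ℕ) (x : WeightedC0 (v k)) :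
    toSeq v (incl v k x) = WeightedC0.toSeq (v k) x := rfl

theorem toSeq_injective : Function.Injective (toSeq v) := Subtype.val_injective

theorem exists_incl_eq (h0 : ∀ k n, 0 ≤ v k n) (hv : Antitone v) (x : Coechelon v) :
    ∃ k y, incl v k y = x := by
  obtain ⟨k, hk⟩ := (mem_coechelonSubmodule_iff h0 hv _).1 x.2
  exact ⟨k, ⟨x.1, hk⟩, rfl⟩

/-- The universal property of the inductive limit topology. -/
theorem continuous_of_comp_incl {F : Type*} [AddCommGroup F] [Module ℂ F] [TopologicalSpace F]
    [IsTopologicalAddGroup F] [ContinuousSMul ℂ F] [LocallyConvexSpace ℝ F]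
    (f : Coechelon v →ₗ[ℂ] F) (hf : ∀ k, Continuous fun x => f (incl v k x)) : Continuous f := by
  rw [continuous_iff_le_induced]
  exact sInf_le ⟨topologicalAddGroup_induced f, continuousSMul_induced f,
    LocallyConvexSpace.induced (f.restrictScalars ℝ), fun k => continuous_induced_rng.2 (hf k)⟩

/-- The `n`-th unit vector as an element of the co-echelon space. -/
def unit (v : ℕ → ℕ → ℝ) (n : ℕ) : Coechelon v := incl v 0 (WeightedC0.unit (v 0) n)

@[simp] theorem toSeq_unit (n : ℕ) : toSeq v (unit v n) = Pi.single n 1 := rfl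

theorem incl_unit (k n : ℕ) : incl v k (WeightedC0.unit (v k) n) = unit v n := rfl

theorem tendsto_sum_smul_unit (h0 : ∀ k n, 0 ≤ v k n) (hv : Antitone v) (x : Coechelon v) :
    Tendsto (fun N => ∑ n ∈ Finset.range N, toSeq v x n • unit v n) atTop (𝓝 x) := by
  obtain ⟨k, y, rfl⟩ := exists_incl_eq h0 hv x
  refine (((continuous_incl v k).tendsto y).comp (WeightedC0.tendsto_sum_smul_unit y)).congr
    fun N => ?_
  simp [map_sum, incl_unit]

/-- A continuous seminorm is dominated by a multiple of the norm on every step. -/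
theorem seminorm_incl_le (p : Seminorm ℂ (Coechelon v)) (hp : Continuous p) (k : ℕ) :
    ∃ C, 0 < C ∧ ∀ x, p (incl v k x) ≤ C * ‖x‖ :=
  (p.comp (incl v k)).bound_of_continuous_normedSpace (hp.comp (continuous_incl v k))

/-- The weight `w` is dominated by a multiple of every weight `v k`. -/
def Dominated (v : ℕ → ℕ → ℝ) (w : ℕ → ℝ) : Prop := ∀ k, ∃ C, ∀ n, |w n| ≤ C * |v k n|

theorem Dominated.le_c0Submodule {w : ℕ → ℝ} (h : Dominated v w) :
    coechelonSubmodule v ≤ c0Submodule w := by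
  refine iSup_le fun k x hx => ?_
  obtain ⟨C, hC⟩ := h k
  have hx' : Tendsto (fun n => C * |v k n * ‖x n‖|) atTop (𝓝 0) := by
    have hx : Tendsto (fun n => v k n * ‖x n‖) atTop (𝓝 0) := hx
    simpa using hx.abs.const_mul C
  refine squeeze_zero_norm (fun n => ?_) hx'
  rw [Real.norm_eq_abs, abs_mul, abs_mul, abs_norm, ← mul_assoc]
  exact mul_le_mul_of_nonneg_right (hC n) (norm_nonneg _)

/-- The inclusion of the co-echelon space into `c₀(w)` for a dominated weight `w`. -/
def toWeightedC0 {w : ℕ → ℝ} (h : Dominated v w) : Coechelon v →ₗ[ℂ] WeightedC0 w :=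
  Submodule.inclusion h.le_c0Submodule

theorem norm_toWeightedC0_incl_le {w : ℕ → ℝ} (h : Dominated v w) {k : ℕ} {C : ℝ}
    (hC : ∀ n, |w n| ≤ C * |v k n|) (x : WeightedC0 (v k)) :
    ‖toWeightedC0 h (incl v k x)‖ ≤ |C| * ‖x‖ := by
  refine WeightedC0.norm_le fun n => ?_
  calc |w n| * ‖WeightedC0.toSeq (v k) x n‖
      ≤ |C| * |v k n| * ‖WeightedC0.toSeq (v k) x n‖ := by
        refine mul_le_mul_of_nonneg_right ((hC n).trans ?_) (norm_nonneg _)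
        exact mul_le_mul_of_nonneg_right (le_abs_self C) (abs_nonneg _)
    _ ≤ |C| * ‖x‖ := by
        rw [mul_assoc]
        exact mul_le_mul_of_nonneg_left (WeightedC0.le_norm _ x n) (abs_nonneg _)

theorem continuous_toWeightedC0 {w : ℕ → ℝ} (h : Dominated v w) :
    Continuous (toWeightedC0 h) := by
  refine continuous_of_comp_incl _ fun k => ?_
  obtain ⟨C, hC⟩ := h k
  exact (((toWeightedC0 h) ∘ₗ (incl v k)).mkContinuous |C|
    (norm_toWeightedC0_incl_le h hC)).continuous

/-- The weighted supremum seminorm on the co-echelon space given by a dominated weight. -/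
def diagSeminorm {w : ℕ → ℝ} (h : Dominated v w) : Seminorm ℂ (Coechelon v) :=
  (WeightedC0.supNorm w).comp (toWeightedC0 h)

theorem continuous_diagSeminorm {w : ℕ → ℝ} (h : Dominated v w) : Continuous (diagSeminorm h) :=
  continuous_norm.comp (continuous_toWeightedC0 h)

theorem le_diagSeminorm {w : ℕ → ℝ} (h : Dominated v w) (x : Coechelon v) (n : ℕ) :
    |w n| * ‖toSeq v x n‖ ≤ diagSeminorm h x :=
  WeightedC0.le_norm w (toWeightedC0 h x) n

end Coechelon

/-! ### Local Banach spaces -/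

namespace LocalBanach

variable {E : Type*} [AddCommGroup E] [Module ℂ E]

/-- The canonical map of a space into the local Banach space of a seminorm. -/
def of (p : Seminorm ℂ E) : E →ₗ[ℂ] LocalBanach p :=
  (UniformSpace.Completion.toComplL (𝕜 := ℂ) (E := SeminormedBy p)).toLinearMap ∘ₗ
    { toFun := fun x => x, map_add' := fun _ _ => rfl, map_smul' := fun _ _ => rfl }

theorem norm_of (p : Seminorm ℂ E) (x : E) : ‖of p x‖ = p x :=
  UniformSpace.Completion.norm_coe (E := SeminormedBy p) x

theorem denseRange_of (p : Seminorm ℂ E) : DenseRange (of p) :=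
  UniformSpace.Completion.denseRange_coe (α := SeminormedBy p)

theorem localBanachMap_of {p q : Seminorm ℂ E} (h : p ≤ q) (x : E) :
    localBanachMap h (of q x) = of p x :=
  ContinuousLinearMap.completion_apply_coe (seminormedId h) x

/-- A functional dominated by a seminorm extends to its local Banach space. -/
theorem exists_extension (p : Seminorm ℂ E) (f : E →ₗ[ℂ] ℂ) {C : ℝ} (hf : ∀ x, ‖f x‖ ≤ C * p x) :
    ∃ g : LocalBanach p →L[ℂ] ℂ, (∀ x, g (of p x) = f x) ∧ ∀ z, ‖g z‖ ≤ C * ‖z‖ := by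
  let f' : SeminormedBy p →ₗ[ℂ] ℂ :=
    { toFun := f, map_add' := fun x y => f.map_add x y, map_smul' := fun c x => f.map_smul c x }
  let F : SeminormedBy p →L[ℂ] ℂ := f'.mkContinuous C hf
  let g : LocalBanach p →L[ℂ] ℂ :=
    F.extend (UniformSpace.Completion.toComplL (𝕜 := ℂ) (E := SeminormedBy p))
  have hg : ∀ x, g (of p x) = f x := fun x =>
    F.extend_eq (e := UniformSpace.Completion.toComplL (𝕜 := ℂ) (E := SeminormedBy p))
      UniformSpace.Completion.denseRange_coe
      (UniformSpace.Completion.isUniformInducing_coe _) x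
  refine ⟨g, hg, fun z => ?_⟩
  refine (denseRange_of p).induction_on z (isClosed_le (by fun_prop) (by fun_prop)) fun x => ?_
  rw [hg, norm_of]
  exact hf x

end LocalBanach

/-! ### Nuclearity of co-echelon spaces -/

theorem summable_inv_succ_sq : Summable fun n : ℕ => (((n : ℝ) + 1) ^ 2)⁻¹ := by
  simpa using (summable_nat_add_iff 1).2 (Real.summable_nat_pow_inv.2 one_lt_two)

/-- A nuclear expansion needs to be checked on a dense set only. -/
theorem IsNuclearOperator.of_denseRange {X Y ι : Type*} [NormedAddCommGroup X] [NormedSpace ℂ X]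
    [NormedAddCommGroup Y] [NormedSpace ℂ Y] [CompleteSpace Y] {T : X →L[ℂ] Y}
    {a : ℕ → X →L[ℂ] ℂ} {y : ℕ → Y} (hsum : Summable fun n => ‖a n‖ * ‖y n‖)
    {f : ι → X} (hf : DenseRange f)
    (h : ∀ x, Tendsto (fun N => ∑ n ∈ Finset.range N, a n (f x) • y n) atTop (𝓝 (T (f x)))) :
    IsNuclearOperator T := by
  have hsum' : Summable fun n => (a n).smulRight (y n) :=
    Summable.of_norm (hsum.congr fun n => ((a n).norm_smulRight_apply (y n)).symm)
  obtain ⟨S, hS⟩ := hsum'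
  have hB : ∀ z, HasSum (fun n => a n z • y n) (S z) := fun z => by
    simpa using (ContinuousLinearMap.apply ℂ Y z).hasSum hS
  have hST : ∀ z, S z = T z := fun z => hf.induction_on z (isClosed_eq S.continuous T.continuous)
    fun x => tendsto_nhds_unique (hB _).tendsto_sum_nat (h x)
  exact ⟨a, y, hsum, fun z => hST z ▸ hB z⟩

namespace Coechelon

variable {v : ℕ → ℕ → ℝ}

/-- The values of a continuous seminorm on the unit vectors, even multiplied by `(n + 1) ^ 2`, are
dominated by all the `v k` if the weights of the steps have the corresponding property. -/
theorem dominated_of_continuous (h : ∀ k, ∃ l M, ∀ n : ℕ, ((n : ℝ) + 1) ^ 2 * |v l n| ≤ M * |v k n|)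
    (p : Seminorm ℂ (Coechelon v)) (hp : Continuous p) (c : ℝ) :
    Dominated v fun n => c * (((n : ℝ) + 1) ^ 2 * p (unit v n)) := by
  intro k
  obtain ⟨l, M, hM⟩ := h k
  obtain ⟨C, hC0, hC⟩ := seminorm_incl_le p hp l
  refine ⟨|c| * (C * M), fun n => ?_⟩
  have h1 : p (unit v n) ≤ C * |v l n| :=
    (hC (WeightedC0.unit (v l) n)).trans
      (mul_le_mul_of_nonneg_left (WeightedC0.norm_unit_le n) hC0.le)
  rw [abs_mul, abs_of_nonneg (mul_nonneg (sq_nonneg ((n : ℝ) + 1)) (apply_nonneg p (unit v n))),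
    mul_assoc]
  refine mul_le_mul_of_nonneg_left ?_ (abs_nonneg c)
  calc ((n : ℝ) + 1) ^ 2 * p (unit v n) ≤ ((n : ℝ) + 1) ^ 2 * (C * |v l n|) := by gcongr
    _ = C * (((n : ℝ) + 1) ^ 2 * |v l n|) := by ring
    _ ≤ C * (M * |v k n|) := mul_le_mul_of_nonneg_left (hM n) hC0.le
    _ = C * M * |v k n| := by ring

/-- Subadditivity along the unit vector expansion of `x`. The normalisation `∑ b ≤ 1` is there
because nuclearity asks for `p ≤ q` itself, not up to a constant. -/
theorem le_of_coord_le (h0 : ∀ k n, 0 ≤ v k n) (hv : Antitone v) {p q : Seminorm ℂ (Coechelon v)}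
    (hp : Continuous p) {b : ℕ → ℝ} (hb0 : ∀ n, 0 ≤ b n) (hb : Summable b) (hb1 : ∑' n, b n ≤ 1)
    (hcoord : ∀ x n, ‖toSeq v x n‖ * p (unit v n) ≤ b n * q x) : p ≤ q := by
  intro x
  have hlim : Tendsto (fun N => p (∑ n ∈ Finset.range N, toSeq v x n • unit v n)) atTop
      (𝓝 (p x)) := (hp.tendsto x).comp (tendsto_sum_smul_unit h0 hv x)
  refine le_of_tendsto' hlim fun N => ?_
  calc p (∑ n ∈ Finset.range N, toSeq v x n • unit v n)
      ≤ ∑ n ∈ Finset.range N, p (toSeq v x n • unit v n) :=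
        Finset.le_sum_of_subadditive p (map_zero p).le (map_add_le_add p) _ _
    _ ≤ ∑ n ∈ Finset.range N, b n * q x := by
        refine Finset.sum_le_sum fun n _ => ?_
        rw [map_smul_eq_mul]
        exact hcoord x n
    _ = (∑ n ∈ Finset.range N, b n) * q x := by rw [Finset.sum_mul]
    _ ≤ 1 * q x := by
        refine mul_le_mul_of_nonneg_right ?_ (apply_nonneg _ _)
        exact (hb.sum_le_tsum _ fun n _ => hb0 n).trans hb1
    _ = q x := one_mul _

/-- The unit vector expansion is itself the nuclear expansion: the factor `p (e n)` is moved into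
the functional, whose norm is then at most `b n`, and the vector is normalised. -/
theorem isNuclearOperator_of_coord_le (h0 : ∀ k n, 0 ≤ v k n) (hv : Antitone v)
    {p q : Seminorm ℂ (Coechelon v)} (hp : Continuous p) {b : ℕ → ℝ} (hb0 : ∀ n, 0 ≤ b n)
    (hb : Summable b) (hcoord : ∀ x n, ‖toSeq v x n‖ * p (unit v n) ≤ b n * q x) (hpq : p ≤ q) :
    IsNuclearOperator (localBanachMap hpq) := by
  have hf : ∀ n, ∃ g : LocalBanach q →L[ℂ] ℂ,
      (∀ x, g (LocalBanach.of q x) = (p (unit v n) : ℂ) * toSeq v x n) ∧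
      ∀ z, ‖g z‖ ≤ b n * ‖z‖ := fun n =>
    LocalBanach.exists_extension q ((p (unit v n) : ℂ) • (LinearMap.proj n ∘ₗ toSeq v)) fun x => by
      have := hcoord x n
      simp only [LinearMap.smul_apply, LinearMap.comp_apply, LinearMap.proj_apply, norm_smul,
        Complex.norm_real, Real.norm_eq_abs, abs_of_nonneg (apply_nonneg p (unit v n))]
      linarith
  choose a ha ha_le using hf
  -- If `p (e n) = 0`, the convention `0⁻¹ = 0` is harmless: `e n` already vanishes in the local
  -- space.
  let y : ℕ → LocalBanach p := fun n => ((p (unit v n))⁻¹ : ℂ) • LocalBanach.of p (unit v n)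
  have hy : ∀ n, ‖y n‖ ≤ 1 := by
    intro n
    simp only [y, norm_smul, LocalBanach.norm_of, norm_inv, Complex.norm_real, Real.norm_eq_abs,
      abs_of_nonneg (apply_nonneg p (unit v n))]
    exact inv_mul_le_one
  have hay : ∀ n x, a n (LocalBanach.of q x) • y n =
      LocalBanach.of p (toSeq v x n • unit v n) := by
    intro n x
    by_cases h : p (unit v n) = 0
    · have : LocalBanach.of p (unit v n) = 0 := by rw [← norm_eq_zero, LocalBanach.norm_of, h]
      simp [y, this]
    · have h' : (p (unit v n) : ℂ) ≠ 0 := by exact_mod_cast h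
      rw [ha, map_smul]
      simp only [y, smul_smul]
      congr 1
      rw [mul_right_comm, mul_inv_cancel₀ h', one_mul]
  have hsum : Summable fun n => ‖a n‖ * ‖y n‖ := by
    refine Summable.of_nonneg_of_le (fun n => by positivity) (fun n => ?_) hb
    exact (mul_le_of_le_one_right (norm_nonneg _) (hy n)).trans
      ((a n).opNorm_le_bound (hb0 n) (ha_le n))
  refine IsNuclearOperator.of_denseRange hsum (LocalBanach.denseRange_of q) fun x => ?_
  rw [LocalBanach.localBanachMap_of, tendsto_iff_norm_sub_tendsto_zero]
  have hlim := (tendsto_sum_smul_unit h0 hv x).sub_const x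
  rw [sub_self] at hlim
  have hlim := (hp.tendsto 0).comp hlim
  rw [map_zero] at hlim
  refine hlim.congr fun N => ?_
  simp only [hay, ← map_sum, ← map_sub, LocalBanach.norm_of, Function.comp]

/-- The seminorm `q` is the sup seminorm with weight `S (n + 1) ^ 2 p (e n)`, where `S = ∑ (n +
1)⁻²` makes the coefficients sum to one. -/
theorem isNuclearSpace_of_sq_mul_le (h0 : ∀ k n, 0 ≤ v k n) (hv : Antitone v)
    (h : ∀ k, ∃ l M, ∀ n : ℕ, ((n : ℝ) + 1) ^ 2 * |v l n| ≤ M * |v k n|) :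
    IsNuclearSpace ℂ (Coechelon v) := by
  intro p hp
  obtain ⟨S, hS, hS_eq⟩ : ∃ S : ℝ, 0 < S ∧ ∑' n : ℕ, (((n : ℝ) + 1) ^ 2)⁻¹ = S :=
    ⟨_, summable_inv_succ_sq.tsum_pos (fun n => by positivity) 0 (by simp), rfl⟩
  have hdom := dominated_of_continuous h p hp S
  have hb : Summable fun n : ℕ => S⁻¹ * (((n : ℝ) + 1) ^ 2)⁻¹ := summable_inv_succ_sq.mul_left _
  have hb0 : ∀ n : ℕ, 0 ≤ S⁻¹ * (((n : ℝ) + 1) ^ 2)⁻¹ := fun n => by positivity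
  have hcoord : ∀ x n, ‖toSeq v x n‖ * p (unit v n) ≤
      S⁻¹ * (((n : ℝ) + 1) ^ 2)⁻¹ * diagSeminorm hdom x := by
    intro x n
    have := le_diagSeminorm hdom x n
    rw [abs_of_nonneg (mul_nonneg hS.le
      (mul_nonneg (sq_nonneg ((n : ℝ) + 1)) (apply_nonneg p (unit v n))))] at this
    rw [← mul_inv, le_inv_mul_iff₀ (by positivity)]
    calc S * ((n : ℝ) + 1) ^ 2 * (‖toSeq v x n‖ * p (unit v n))
        = S * (((n : ℝ) + 1) ^ 2 * p (unit v n)) * ‖toSeq v x n‖ := by ring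
      _ ≤ _ := this
  have hpq := le_of_coord_le h0 hv hp hb0 hb
    (by rw [tsum_mul_left, hS_eq, inv_mul_cancel₀ hS.ne']) hcoord
  exact ⟨diagSeminorm hdom, continuous_diagSeminorm hdom, hpq,
    isNuclearOperator_of_coord_le h0 hv hp hb0 hb hcoord hpq⟩

/-- The trace estimate for the canonical map between the local Banach spaces of a weighted
supremum seminorm and a larger continuous seminorm. -/
theorem card_le_of_isNuclearSpace (hE : IsNuclearSpace ℂ (Coechelon v)) {w : ℕ → ℝ}
    (hw : ∀ n, 0 < w n) (hdom : Dominated v w) (k : ℕ) :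
    ∃ C, 0 ≤ C ∧ ∀ (N : ℕ) (B : ℝ), 0 ≤ B → (∀ n < N, |v k n| * (w n)⁻¹ ≤ B) → (N : ℝ) ≤ C * B := by
  obtain ⟨q, hq, hpq, a, y, hsum, hT⟩ := hE _ (continuous_diagSeminorm hdom)
  obtain ⟨C, hC0, hC⟩ := seminorm_incl_le q hq k
  have hf : ∀ n, ∃ g : LocalBanach (diagSeminorm hdom) →L[ℂ] ℂ,
      (∀ x, g (LocalBanach.of _ x) = toSeq v x n) ∧ ∀ z, ‖g z‖ ≤ (w n)⁻¹ * ‖z‖ := fun n =>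
    LocalBanach.exists_extension _ (LinearMap.proj n ∘ₗ toSeq v) fun x => by
      have := le_diagSeminorm hdom x n
      rw [abs_of_pos (hw n)] at this
      rw [le_inv_mul_iff₀ (hw n)]
      exact this
  choose c hc hc_le using hf
  refine ⟨C * ∑' i, ‖a i‖ * ‖y i‖, by positivity, fun N B hB0 hB => ?_⟩
  -- The `n`-th diagonal entry of the identity, computed from the nuclear expansion.
  have hdiag : ∀ n, HasSum (fun i => a i (LocalBanach.of q (unit v n)) * c n (y i)) 1 := by
    intro n
    have := (c n).hasSum (hT (LocalBanach.of q (unit v n)))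
    rw [LocalBanach.localBanachMap_of, hc, toSeq_unit, Pi.single_eq_same] at this
    simpa using this
  have htrace : HasSum (fun i => ∑ n ∈ Finset.range N,
      a i (LocalBanach.of q (unit v n)) * c n (y i)) (N : ℂ) := by
    simpa using hasSum_sum (s := Finset.range N) fun n _ => hdiag n
  have hbound : ∀ i, ‖∑ n ∈ Finset.range N, a i (LocalBanach.of q (unit v n)) * c n (y i)‖ ≤
      C * B * (‖a i‖ * ‖y i‖) := by
    intro i
    -- For fixed `i` the sum over `n` is `a i` at a single vector of `c₀(v k)`. Its norm is a
    -- supremum, not a sum, so the bound does not grow with `N`.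
    set z : WeightedC0 (v k) :=
      ∑ n ∈ Finset.range N, c n (y i) • WeightedC0.unit (v k) n with hz
    have hz_le : ‖z‖ ≤ B * ‖y i‖ := by
      refine WeightedC0.norm_le fun n => ?_
      rw [hz, WeightedC0.toSeq_sum_smul_unit fun n => c n (y i)]
      split_ifs with h
      · calc |v k n| * ‖c n (y i)‖ ≤ |v k n| * ((w n)⁻¹ * ‖y i‖) := by gcongr; exact hc_le n _
          _ = |v k n| * (w n)⁻¹ * ‖y i‖ := by ring
          _ ≤ B * ‖y i‖ := by gcongr; exact hB n h
      · simpa using mul_nonneg hB0 (norm_nonneg _)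
    have heq : ∑ n ∈ Finset.range N, a i (LocalBanach.of q (unit v n)) * c n (y i) =
        a i (LocalBanach.of q (incl v k z)) := by
      simp [hz, map_sum, incl_unit, mul_comm]
    rw [heq]
    calc ‖a i (LocalBanach.of q (incl v k z))‖ ≤ ‖a i‖ * ‖LocalBanach.of q (incl v k z)‖ :=
          (a i).le_opNorm _
      _ ≤ ‖a i‖ * (C * (B * ‖y i‖)) := by
          rw [LocalBanach.norm_of]
          gcongr
          exact (hC z).trans (by gcongr)
      _ = C * B * (‖a i‖ * ‖y i‖) := by ring
  have := htrace.norm_le_of_bounded (hsum.mul_left (C * B)).hasSum hbound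
  rw [tsum_mul_left, Complex.norm_natCast] at this
  linarith

end Coechelon

/-! ### The weights of power series spaces -/

section PowerWeight

variable {α s : ℕ → ℝ}

theorem powerWeight_pos (hs : ∀ k, 1 < s k) (k n : ℕ) : 0 < powerWeight α s k n :=
  Real.rpow_pos_of_pos (zero_lt_one.trans (hs k)) _

theorem powerWeight_eq_exp (hs : ∀ k, 1 < s k) (k n : ℕ) :
    powerWeight α s k n = Real.exp (-(Real.log (s k) * α n)) := by
  rw [powerWeight, Real.rpow_def_of_pos (zero_lt_one.trans (hs k)), mul_neg]

theorem powerWeight_antitone (hα : ∀ n, 0 < α n) (hs : ∀ k, 1 < s k) (hs' : Monotone s) :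
    Antitone (powerWeight α s) := fun k _ hkl n =>
  Real.rpow_le_rpow_of_nonpos (zero_lt_one.trans (hs k)) (hs' hkl) (neg_nonpos.2 (hα n).le)

theorem exists_lt_le_log (hs_lim : Tendsto s atTop atTop) (k : ℕ) (c : ℝ) :
    ∃ l, k < l ∧ c ≤ Real.log (s l) :=
  ((eventually_gt_atTop k).and
    ((Real.tendsto_log_atTop.comp hs_lim).eventually_ge_atTop c)).exists

/-- The weight inequality in terms of the growth of the exponents. -/
theorem weight_inequality_of_growth (hα : ∀ n, 0 < α n) (hs : ∀ k, 1 < s k)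
    (hs_lim : Tendsto s atTop atTop) {R β : ℝ} (hR : ∀ n, α (n + 1) ≤ R * α n)
    (hβ : ∀ n : ℕ, Real.log ((n : ℝ) + 1) ≤ β * α n) (k : ℕ) :
    ∃ l, k < l ∧ ∃ M : ℝ, 0 < M ∧
      ∀ n : ℕ, ((n : ℝ) + 1) * powerWeight α s l n ≤ M * powerWeight α s k (n + 1) := by
  obtain ⟨l, hkl, hl⟩ := exists_lt_le_log hs_lim k (Real.log (s k) * R + β)
  refine ⟨l, hkl, 1, one_pos, fun n => ?_⟩
  have hn : (0 : ℝ) < (n : ℝ) + 1 := by positivity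
  rw [one_mul, powerWeight_eq_exp hs, powerWeight_eq_exp hs, ← Real.exp_log hn, ← Real.exp_add,
    Real.exp_le_exp]
  have h1 := mul_le_mul_of_nonneg_right hl (hα n).le
  have h2 := mul_le_mul_of_nonneg_left (hR n) (Real.log_pos (hs k)).le
  linarith [hβ n]

/-- Logarithms of both sides; the additive constant `log M` is absorbed using `α 0 ≤ α n`. -/
theorem growth_of_weight_inequality (hα : ∀ n, 0 < α n) (hα_mono : Monotone α)
    (hs : ∀ k, 1 < s k) {k l : ℕ} {M : ℝ} (hM : 0 < M)
    (h : ∀ n : ℕ, ((n : ℝ) + 1) * powerWeight α s l n ≤ M * powerWeight α s k (n + 1)) :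
    ∃ C, ∀ n : ℕ, Real.log ((n : ℝ) + 1) + Real.log (s k) * α (n + 1) ≤ C * α n := by
  refine ⟨|Real.log M| / α 0 + Real.log (s l), fun n => ?_⟩
  have hn : (0 : ℝ) < (n : ℝ) + 1 := by positivity
  have := h n
  rw [powerWeight_eq_exp hs, powerWeight_eq_exp hs, ← Real.exp_log hn, ← Real.exp_log hM,
    ← Real.exp_add, ← Real.exp_add, Real.exp_le_exp] at this
  have h1 : |Real.log M| ≤ |Real.log M| / α 0 * α n := by
    rw [div_mul_eq_mul_div, le_div_iff₀ (hα 0)]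
    exact mul_le_mul_of_nonneg_left (hα_mono (Nat.zero_le n)) (abs_nonneg _)
  linarith [le_abs_self (Real.log M)]

/-- The upper limit controls only a tail of the ratios; the finitely many others merely enlarge `R`.
-/
theorem shiftStable_iff (hα : ∀ n, 0 < α n) :
    ShiftStable α ↔ ∃ R, ∀ n, α (n + 1) ≤ R * α n := by
  constructor
  · intro h
    obtain ⟨b, hb, hb'⟩ := EReal.lt_iff_exists_real_btwn.1 h
    have hev := eventually_lt_of_limsup_lt hb
    obtain ⟨N, hN⟩ := eventually_atTop.1 hev
    obtain ⟨B, hB⟩ := ((Set.finite_lt_nat N).image fun n => α (n + 1) / α n).bddAbove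
    refine ⟨max b B, fun n => ?_⟩
    rw [← div_le_iff₀ (hα n)]
    rcases lt_or_ge n N with h | h
    · exact (hB ⟨n, h, rfl⟩).trans (le_max_right _ _)
    · exact (EReal.coe_lt_coe_iff.1 (hN n h)).le.trans (le_max_left _ _)
  · rintro ⟨R, hR⟩
    refine lt_of_le_of_lt (limsup_le_of_le (a := (R : EReal)) (by isBoundedDefault)
      (Eventually.of_forall fun n => ?_)) (EReal.coe_lt_top R)
    exact EReal.coe_le_coe_iff.2 ((div_le_iff₀ (hα n)).2 (hR n))

theorem isNuclearSpace_of_log_le (hα : ∀ n, 0 < α n) (hs : ∀ k, 1 < s k) (hs_mono : Monotone s)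
    (hs_lim : Tendsto s atTop atTop) {β : ℝ} (hβ : ∀ n : ℕ, Real.log ((n : ℝ) + 1) ≤ β * α n) :
    IsNuclearSpace ℂ (ESpace α s) := by
  refine Coechelon.isNuclearSpace_of_sq_mul_le (fun k n => (powerWeight_pos hs k n).le)
    (powerWeight_antitone hα hs hs_mono) fun k => ?_
  obtain ⟨l, -, hl⟩ := exists_lt_le_log hs_lim k (Real.log (s k) + 2 * β)
  refine ⟨l, 1, fun n => ?_⟩
  have hn : (0 : ℝ) < (n : ℝ) + 1 := by positivity
  rw [one_mul, abs_of_pos (powerWeight_pos hs _ _), abs_of_pos (powerWeight_pos hs _ _),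
    powerWeight_eq_exp hs, powerWeight_eq_exp hs, ← Real.exp_log (pow_pos hn 2), ← Real.exp_add,
    Real.exp_le_exp, Real.log_pow]
  have h1 := mul_le_mul_of_nonneg_right hl (hα n).le
  push_cast
  linarith [hβ n]

/-- Weights `exp (-r n * α n)` with `r n → ∞` are dominated by all the power weights. -/
theorem dominated_exp_neg_mul (hα : ∀ n, 0 < α n) (hs : ∀ k, 1 < s k) {r : ℕ → ℝ}
    (hr : Tendsto r atTop atTop) :
    Coechelon.Dominated (powerWeight α s) fun n => Real.exp (-(r n * α n)) := by
  intro k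
  obtain ⟨N, hN⟩ := eventually_atTop.1 (hr.eventually_ge_atTop (Real.log (s k)))
  obtain ⟨B, hB⟩ := ((Set.finite_lt_nat N).image
    fun n => Real.exp (Real.log (s k) * α n - r n * α n)).bddAbove
  refine ⟨max 1 B, fun n => ?_⟩
  rw [abs_of_pos (Real.exp_pos _), abs_of_pos (powerWeight_pos hs k n), powerWeight_eq_exp hs,
    ← div_le_iff₀ (Real.exp_pos _), ← Real.exp_sub]
  rcases lt_or_ge n N with h | h
  · refine (le_of_eq ?_).trans ((hB ⟨n, h, rfl⟩).trans (le_max_right _ _))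
    ring_nf
  · refine (Real.exp_le_one_iff.2 ?_).trans (le_max_left _ _)
    linarith [mul_le_mul_of_nonneg_right (hN n h) (hα n).le]

/-- If `b n = log (n + 1) / α n` were unbounded, half its running maximum would be an admissible
rate `r`, and the trace estimate would give `n + 1 ≤ C exp (r n * α n)`. Where the maximum is
attained, the right side is only `C √(n + 1)`, which bounds `b` after all. -/
theorem log_le_of_isNuclearSpace (hα : ∀ n, 0 < α n) (hα_mono : Monotone α) (hs : ∀ k, 1 < s k)
    (hE : IsNuclearSpace ℂ (ESpace α s)) :
    ∃ β, ∀ n : ℕ, Real.log ((n : ℝ) + 1) ≤ β * α n := by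
  let b : ℕ → ℝ := fun n => Real.log ((n : ℝ) + 1) / α n
  suffices h : BddAbove (Set.range (partialSups b)) by
    obtain ⟨β, hβ⟩ := h
    exact ⟨β, fun n => (div_le_iff₀ (hα n)).1 ((le_partialSups b n).trans (hβ ⟨n, rfl⟩))⟩
  by_contra hunb
  have hr : Tendsto (fun n => partialSups b n / 2) atTop atTop :=
    (tendsto_atTop_atTop_of_monotone' (partialSups_monotone b) hunb).atTop_div_const two_pos
  have hb0 : ∀ n, 0 ≤ partialSups b n := fun n => by
    refine le_trans ?_ (le_partialSups_of_le b (Nat.zero_le n))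
    simp [b]
  obtain ⟨C, hC0, hC⟩ := Coechelon.card_le_of_isNuclearSpace hE (fun n => Real.exp_pos _)
    (dominated_exp_neg_mul hα hs hr) 0
  have key : ∀ n : ℕ, (n : ℝ) + 1 ≤ C * Real.exp (partialSups b n / 2 * α n) := by
    intro n
    -- The running maximum makes `r m * α m` monotone, so the index `n` bounds all `m ≤ n`; the
    -- factor `v_0(m) ≤ 1` is discarded.
    have := hC (n + 1) (Real.exp (partialSups b n / 2 * α n)) (Real.exp_pos _).le fun m hm => by
      have hmn : m ≤ n := Nat.lt_succ_iff.1 hm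
      rw [abs_of_pos (powerWeight_pos hs 0 m), powerWeight_eq_exp hs, ← Real.exp_neg,
        ← Real.exp_add, Real.exp_le_exp, neg_neg]
      have h1 : partialSups b m / 2 * α m ≤ partialSups b n / 2 * α n :=
        mul_le_mul (by linarith [partialSups_monotone b hmn]) (hα_mono hmn) (hα m).le
          (by linarith [hb0 n])
      linarith [mul_pos (Real.log_pos (hs 0)) (hα m)]
    exact_mod_cast this
  have hCpos : 0 < C := by
    refine hC0.lt_of_ne fun h => ?_
    have := key 0
    simp only [← h, zero_mul] at this
    norm_num at this
  refine hunb ⟨2 * |Real.log C| / α 0, ?_⟩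
  rintro _ ⟨N, rfl⟩
  -- At such an `m`, `key` reads `log (m + 1) ≤ log C + log (m + 1) / 2`.
  obtain ⟨m, hmN, hm⟩ := exists_partialSups_eq b N
  rw [hm]
  have hm' : partialSups b m ≤ b m := by
    rw [← hm]
    exact partialSups_monotone b hmN
  have hlog := Real.log_le_log (by positivity) (key m)
  rw [Real.log_mul hCpos.ne' (Real.exp_pos _).ne', Real.log_exp] at hlog
  have h1 : b m * α m = Real.log ((m : ℝ) + 1) := div_mul_cancel₀ _ (hα m).ne'
  have h2 := mul_le_mul_of_nonneg_right hm' (hα m).le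
  have h3 : b m * α m ≤ 2 * |Real.log C| := by linarith [le_abs_self (Real.log C)]
  rw [le_div_iff₀ (hα 0)]
  refine le_trans ?_ h3
  exact mul_le_mul_of_nonneg_left (hα_mono (Nat.zero_le m)) ((hb0 m).trans hm')

end PowerWeight

/-! ### Differentiation between weighted spaces -/

section Differentiation

/-- The differentiation operator acts continuously between weighted `c₀`-spaces if the weights
satisfy the corresponding inequality. -/
theorem exists_diffOp_weightedC0 {v w : ℕ → ℝ} {M : ℝ} (hM : 0 ≤ M)
    (h : ∀ n : ℕ, ((n : ℝ) + 1) * |w n| ≤ M * |v (n + 1)|) :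
    ∃ T : WeightedC0 v →L[ℂ] WeightedC0 w,
      ∀ x, WeightedC0.toSeq _ (T x) = diffOp (WeightedC0.toSeq _ x) := by
  have hle : ∀ (x : ℕ → ℂ) (n : ℕ), |w n| * ‖diffOp x n‖ ≤ M * (|v (n + 1)| * ‖x (n + 1)‖) := by
    intro x n
    have hn : ‖diffOp x n‖ = ((n : ℝ) + 1) * ‖x (n + 1)‖ := by
      change ‖((n : ℂ) + 1) * x (n + 1)‖ = _
      rw [norm_mul]
      congr 1
      exact_mod_cast Complex.norm_natCast (n + 1)
    calc |w n| * ‖diffOp x n‖ = ((n : ℝ) + 1) * |w n| * ‖x (n + 1)‖ := by rw [hn]; ring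
      _ ≤ M * |v (n + 1)| * ‖x (n + 1)‖ := mul_le_mul_of_nonneg_right (h n) (norm_nonneg _)
      _ = _ := by ring
  have hmem : ∀ x : WeightedC0 v, diffOp (WeightedC0.toSeq v x) ∈ c0Submodule w := by
    intro x
    have hx : Tendsto (fun n => M * |v (n + 1) * ‖WeightedC0.toSeq v x (n + 1)‖|) atTop (𝓝 0) := by
      simpa using (((tendsto_add_atTop_iff_nat 1).2 (WeightedC0.tendsto_toSeq x)).abs.const_mul M)
    refine squeeze_zero_norm (fun n => ?_) hx
    rw [Real.norm_eq_abs, abs_mul, abs_mul, abs_norm, abs_norm]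
    exact hle _ n
  let T : WeightedC0 v →ₗ[ℂ] WeightedC0 w :=
    LinearMap.codRestrict (c0Submodule w) (diffOp ∘ₗ WeightedC0.toSeq v) hmem
  refine ⟨T.mkContinuous M fun x => WeightedC0.norm_le fun n => (hle _ n).trans ?_, fun x => rfl⟩
  exact mul_le_mul_of_nonneg_left (WeightedC0.le_norm v x (n + 1)) hM

/-- An operator on sequences that acts continuously between the steps acts continuously on the
co-echelon space. -/
theorem Coechelon.exists_continuousLinearMap {v : ℕ → ℕ → ℝ} (A : (ℕ → ℂ) →ₗ[ℂ] (ℕ → ℂ))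
    (h : ∀ k, ∃ l, ∃ T : WeightedC0 (v k) →L[ℂ] WeightedC0 (v l),
      ∀ x, WeightedC0.toSeq _ (T x) = A (WeightedC0.toSeq _ x)) :
    ∃ T : Coechelon v →L[ℂ] Coechelon v, ∀ x, toSeq _ (T x) = A (toSeq _ x) := by
  have hle : coechelonSubmodule v ≤ (coechelonSubmodule v).comap A := by
    refine iSup_le fun k x hx => ?_
    obtain ⟨l, T, hT⟩ := h k
    have : A x = WeightedC0.toSeq _ (T ⟨x, hx⟩) := (hT ⟨x, hx⟩).symm
    rw [Submodule.mem_comap, this]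
    exact (incl v l (T ⟨x, hx⟩)).2
  let T : Coechelon v →ₗ[ℂ] Coechelon v :=
    LinearMap.codRestrict (coechelonSubmodule v) (A ∘ₗ toSeq v) fun x => hle x.2
  refine ⟨⟨T, continuous_of_comp_incl T fun k => ?_⟩, fun x => rfl⟩
  obtain ⟨l, S, hS⟩ := h k
  refine ((continuous_incl v l).comp S.continuous).congr fun x => toSeq_injective ?_
  exact hS x

/-- If the differentiation operator maps `c₀(v)` into the union of the spaces `c₀(w l)`, then the
weights satisfy the corresponding inequality for some `l`, by a gliding hump. -/
theorem exists_weight_inequality_of_diffOp {v : ℕ → ℝ} {w : ℕ → ℕ → ℝ} (hv : ∀ n, 0 < v n)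
    (hw_anti : Antitone w)
    (h : ∀ x ∈ c0Submodule v, ∃ l, diffOp x ∈ c0Submodule (w l)) (k : ℕ) :
    ∃ l, k < l ∧ ∃ M : ℝ, 0 < M ∧ ∀ n : ℕ, ((n : ℝ) + 1) * w l n ≤ M * v (n + 1) := by
  by_contra! hcon
  have hlarge : ∀ j N : ℕ, ∃ n, N < n ∧
      ((j : ℝ) + 1) * v (n + 1) < ((n : ℝ) + 1) * w (k + 1 + j) n := by
    intro j N
    -- A constant exceeding all ratios with `n ≤ N` forces the violating index beyond `N`.
    obtain ⟨B, hB⟩ := ((Set.finite_le_nat N).image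
      fun n : ℕ => ((n : ℝ) + 1) * w (k + 1 + j) n / v (n + 1)).bddAbove
    obtain ⟨n, hn⟩ := hcon (k + 1 + j) (by omega) (max B (j + 1)) (by positivity)
    refine ⟨n, lt_of_not_ge fun hnN => ?_, lt_of_le_of_lt ?_ hn⟩
    · refine hn.not_ge ?_
      rw [← div_le_iff₀ (hv _)]
      exact (hB ⟨n, hnN, rfl⟩).trans (le_max_left _ _)
    · exact mul_le_mul_of_nonneg_right (le_max_right _ _) (hv _).le
  choose g hg_lt hg using hlarge
  obtain ⟨m, hm0, hm_succ⟩ : ∃ m : ℕ → ℕ, m 0 = g 0 0 ∧ ∀ i, m (i + 1) = g (i + 1) (m i) :=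
    ⟨Nat.rec (g 0 0) fun i a => g (i + 1) a, rfl, fun _ => rfl⟩
  have hm_mono : StrictMono m := strictMono_nat_of_lt_succ fun j => hm_succ j ▸ hg_lt (j + 1) (m j)
  have hm : ∀ j : ℕ,
      ((j : ℝ) + 1) * v (m j + 1) < (((m j : ℕ) : ℝ) + 1) * w (k + 1 + j) (m j) := by
    intro j
    cases j with
    | zero => rw [hm0]; exact hg 0 0
    | succ i => rw [hm_succ]; exact hg (i + 1) (m i)
  have hinj : Function.Injective fun j => m j + 1 := fun i j hij =>
    hm_mono.injective (Nat.succ_injective hij)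
  -- The humps have weighted size `1 / (j + 1)`, hence `x ∈ c₀(v)`. They sit at `m j + 1`, which
  -- `diffOp` moves to `m j`, where the violated inequality makes the image exceed `1`.
  let c : ℕ → ℂ := fun j => ((((j : ℝ) + 1) * v (m j + 1))⁻¹ : ℝ)
  let x : ℕ → ℂ := Function.extend (fun j => m j + 1) c 0
  have hx : ∀ j, x (m j + 1) = c j := fun j => hinj.extend_apply c 0 j
  have hc : ∀ j, ‖c j‖ = (((j : ℝ) + 1) * v (m j + 1))⁻¹ := fun j => by
    have := hv (m j + 1)
    rw [Complex.norm_real, Real.norm_eq_abs, abs_of_pos (by positivity)]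
  have hx_mem : x ∈ c0Submodule v := by
    change Tendsto (fun n => v n * ‖x n‖) atTop (𝓝 0)
    rw [Metric.tendsto_atTop]
    intro ε hε
    obtain ⟨J, hJ⟩ := exists_nat_one_div_lt hε
    refine ⟨m J + 1, fun n hn => ?_⟩
    rw [Real.dist_eq, sub_zero, abs_of_nonneg (mul_nonneg (hv n).le (norm_nonneg _))]
    by_cases hex : ∃ j, m j + 1 = n
    · obtain ⟨j, rfl⟩ := hex
      have hJj : J ≤ j := hm_mono.le_iff_le.1 (Nat.succ_le_succ_iff.1 hn)
      have hvj := hv (m j + 1)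
      rw [hx, hc, mul_inv, mul_left_comm, mul_inv_cancel₀ hvj.ne', mul_one, ← one_div]
      refine lt_of_le_of_lt ?_ hJ
      gcongr
    · have : x n = 0 := Function.extend_apply' c (0 : ℕ → ℂ) n hex
      simpa [this] using hε
  obtain ⟨l, hl⟩ := h x hx_mem
  have hl : Tendsto (fun n => w l n * ‖diffOp x n‖) atTop (𝓝 0) := hl
  have hl' := (hl.comp hm_mono.tendsto_atTop).eventually (gt_mem_nhds one_pos)
  -- For `j ≥ l` the hump was built against the step `k + 1 + j ≥ l`, whose weight is at most `w l`.
  obtain ⟨j, hj1, hj2⟩ := (hl'.and (eventually_ge_atTop l)).exists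
  refine hj1.not_ge ?_
  have hdiff : ‖diffOp x (m j)‖ = ((m j : ℝ) + 1) * ‖c j‖ := by
    change ‖((m j : ℂ) + 1) * x (m j + 1)‖ = _
    rw [norm_mul, hx]
    congr 1
    exact_mod_cast Complex.norm_natCast (m j + 1)
  have hvj := hv (m j + 1)
  have hw_le : w (k + 1 + j) (m j) ≤ w l (m j) := hw_anti (by omega) (m j)
  have hm_lt := (hm j).le.trans (mul_le_mul_of_nonneg_left hw_le (by positivity))
  change 1 ≤ w l (m j) * ‖diffOp x (m j)‖
  rw [hdiff, hc, ← mul_assoc, le_mul_inv_iff₀ (by positivity), one_mul]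
  linarith

end Differentiation

end

theorem proposition2p5 (α s : ℕ → ℝ)
    (hα_pos : ∀ n, 0 < α n) (hα_mono : StrictMono α) (hα_lim : Tendsto α atTop atTop)
    (hs_one : ∀ k, 1 < s k) (hs_mono : StrictMono s) (hs_lim : Tendsto s atTop atTop) :
    List.TFAE [
      -- `D` acts in `E_α`
      ∀ x ∈ coechelonSubmodule (powerWeight α s), diffOp x ∈ coechelonSubmodule (powerWeight α s),
      -- `D` is a continuous linear operator on `E_α`
      ∃ T : ESpace α s →L[ℂ] ESpace α s,
        ∀ x, Coechelon.toSeq _ (T x) = diffOp (Coechelon.toSeq _ x),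
      -- for every `k` there is `l > k` such that `D : c₀(v_k) → c₀(v_l)` is continuous
      ∀ k, ∃ l, k < l ∧ ∃ T : WeightedC0 (powerWeight α s k) →L[ℂ] WeightedC0 (powerWeight α s l),
        ∀ x, WeightedC0.toSeq _ (T x) = diffOp (WeightedC0.toSeq _ x),
      -- the weight inequality
      ∀ k, ∃ l, k < l ∧ ∃ M : ℝ, 0 < M ∧
        ∀ n : ℕ, ((n : ℝ) + 1) * powerWeight α s l n ≤ M * powerWeight α s k (n + 1),
      -- `E_α` is nuclear and shift stable
      IsNuclearSpace ℂ (ESpace α s) ∧ ShiftStable α] := by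
  have hpos := powerWeight_pos (α := α) hs_one
  have hanti := powerWeight_antitone hα_pos hs_one hs_mono.monotone
  tfae_have 1 → 4 := by
    intro h k
    refine exists_weight_inequality_of_diffOp (hpos k) hanti (fun x hx => ?_) k
    rw [← mem_powerWeight_coechelon_iff hα_pos hs_one hs_mono]
    exact h x ((mem_powerWeight_coechelon_iff hα_pos hs_one hs_mono x).2 ⟨k, hx⟩)
  tfae_have 4 → 3 := by
    intro h k
    obtain ⟨l, hkl, M, hM, hle⟩ := h k
    refine ⟨l, hkl, exists_diffOp_weightedC0 hM.le fun n => ?_⟩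
    rw [abs_of_pos (hpos l n), abs_of_pos (hpos k (n + 1))]
    exact hle n
  tfae_have 3 → 2 := fun h => Coechelon.exists_continuousLinearMap diffOp fun k =>
    let ⟨l, _, hl⟩ := h k
    ⟨l, hl⟩
  tfae_have 2 → 1 := by
    rintro ⟨T, hT⟩ x hx
    have h : (T ⟨x, hx⟩).1 = diffOp x := hT ⟨x, hx⟩
    rw [← h]
    exact (T ⟨x, hx⟩).2
  tfae_have 4 → 5 := by
    intro h
    -- One step suffices: as `log (s 0) > 0`, each term on the left of the growth estimate is
    -- bounded separately.
    obtain ⟨l, -, M, hM, hle⟩ := h 0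
    obtain ⟨C, hC⟩ := growth_of_weight_inequality hα_pos hα_mono.monotone hs_one hM hle
    have hlog := Real.log_pos (hs_one 0)
    refine ⟨isNuclearSpace_of_log_le hα_pos hs_one hs_mono.monotone hs_lim (β := C) fun n => ?_,
      (shiftStable_iff hα_pos).2 ⟨C / Real.log (s 0), fun n => ?_⟩⟩
    · linarith [hC n, mul_pos hlog (hα_pos (n + 1))]
    · rw [div_mul_eq_mul_div, le_div_iff₀ hlog]
      linarith [hC n, Real.log_nonneg (by linarith [(Nat.cast_nonneg n : (0 : ℝ) ≤ n)] :
        (1 : ℝ) ≤ (n : ℝ) + 1)]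
  tfae_have 5 → 4 := by
    rintro ⟨hE, hα_stable⟩
    obtain ⟨β, hβ⟩ := log_le_of_isNuclearSpace hα_pos hα_mono.monotone hs_one hE
    obtain ⟨R, hR⟩ := (shiftStable_iff hα_pos).1 hα_stable
    exact weight_inequality_of_growth hα_pos hs_one hs_lim hR hβ
  tfae_finish
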